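/- An MV-algebra is an abelian monoid $(M,\oplus,0)$ with a unary operation $^*$ such that $(x^*)^*=x$, $x\oplus 0^*=0^*$ and $(x^*\oplus y)^*\oplus y=(y^*\oplus x)^*\oplus x$ for all $x,y\in M$. It is called an MV-chain if its natural order, given by $x\le y \iff x^*\oplus y=0^*$, is total. For a natural number $n\ge 2$ let $\pi(n)$ be the number of non-trivial unordered decompositions of $n$ into factors greater than $1$, that is, the number of multisets of at least two integers, all greater than $1$, whose product is $n$. **Proposition.** For every natural number $n\ge 2$ there are, up to isomorphism, exactly $\pi(n)+1$ MV-algebras with $n$ elements. More precisely, up to isomorphism there is exactly one MV-chain with $n$ elements, and there are exactly $\pi(n)$ MV-algebras with $n$ elements that are isomorphic to a product of finitely many, but at least two, MV-chains each having more than one element; the latter are precisely the $n$-element MV-algebras that are not MV-chains. -/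

import Mathlib

universe u v

/-- An MV-algebra: an abelian monoid `(M, ⊕, 0)`, written additively, with a unary operation
`neg` (the `x ↦ x*` of the literature) satisfying MV1 - MV3. -/
class MVAlgebra (M : Type u) extends AddCommMonoid M where
  /-- the unary operation `x ↦ x*` -/
  neg : M → M
  /-- MV1: `(x*)* = x` -/
  neg_neg' : ∀ x : M, neg (neg x) = x
  /-- MV2: `x ⊕ 0* = 0*` -/
  add_neg_zero' : ∀ x : M, x + neg 0 = neg 0
  /-- MV3: `(x* ⊕ y)* ⊕ y = (y* ⊕ x)* ⊕ x` -/
  luk' : ∀ x y : M, neg (neg x + y) + y = neg (neg y + x) + x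

namespace MVAlgebra

/-- The natural order of an MV-algebra: `x ≤ y` iff `x* ⊕ y = 1`, where `1 = 0*`. -/
def le {M : Type u} [MVAlgebra M] (x y : M) : Prop :=
  neg x + y = neg (0 : M)

/-- An MV-chain: the natural order is total. -/
def IsMVChain (M : Type u) [MVAlgebra M] : Prop :=
  ∀ x y : M, le x y ∨ le y x

/-- The product of a family of MV-algebras, with componentwise operations. -/
instance instPi {ι : Type v} (C : ι → Type u) [∀ i, MVAlgebra (C i)] :
    MVAlgebra (∀ i, C i) where
  neg x := fun i => neg (x i)
  neg_neg' x := funext fun i => neg_neg' (x i)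
  add_neg_zero' x := funext fun i => add_neg_zero' (x i)
  luk' x y := funext fun i => luk' (x i) (y i)

/-- Isomorphisms of MV-algebras: bijections preserving `⊕` and `*` (and hence also `0`). -/
structure Iso (M : Type u) (N : Type v) [MVAlgebra M] [MVAlgebra N] extends M ≃+ N where
  map_neg' : ∀ x : M, toFun (neg x) = neg (toFun x)

/-- `M` is isomorphic to a product of finitely many, but at least two, MV-chains, each of
which has more than one element. -/
def IsProductOfChains (M : Type u) [MVAlgebra M] : Prop :=
  ∃ (k : ℕ) (C : Fin k → Type u) (_ : ∀ i, MVAlgebra (C i)),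
    2 ≤ k ∧ (∀ i, Nontrivial (C i) ∧ IsMVChain (C i)) ∧ Nonempty (Iso M (∀ i, C i))

end MVAlgebra

/-- Bundled MV-algebras. -/
structure MVAlg where
  carrier : Type u
  [str : MVAlgebra carrier]

namespace MVAlg

instance instStr (A : MVAlg.{u}) : MVAlgebra A.carrier := A.str

/-- Being isomorphic, as an equivalence relation on MV-algebras. -/
def isoSetoid : Setoid MVAlg.{u} where
  r A B := Nonempty (MVAlgebra.Iso A.carrier B.carrier)
  iseqv :=
    { refl := fun A => ⟨{ AddEquiv.refl A.carrier with map_neg' := fun _ => rfl }⟩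
      symm := fun {A B} ⟨e⟩ => ⟨{ e.toAddEquiv.symm with
        map_neg' := fun y => by
          have h := e.map_neg' (e.toAddEquiv.symm y)
          apply e.toAddEquiv.injective
          change e.toAddEquiv (e.toAddEquiv.symm (MVAlgebra.neg y)) =
            e.toFun (MVAlgebra.neg (e.toAddEquiv.symm y))
          rw [h]
          change _ = MVAlgebra.neg (e.toAddEquiv (e.toAddEquiv.symm y))
          simp }⟩
      trans := fun {A B C} ⟨e⟩ ⟨f⟩ => ⟨{ e.toAddEquiv.trans f.toAddEquiv with
        map_neg' := fun x => by
          change f.toFun (e.toFun (MVAlgebra.neg x)) = MVAlgebra.neg (f.toFun (e.toFun x))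
          rw [e.map_neg', f.map_neg'] }⟩ }

/-- The set of isomorphism classes of the `n`-element MV-algebras with property `P`. -/
def isoClasses (n : ℕ) (P : MVAlg.{u} → Prop) : Set (Quotient isoSetoid.{u}) :=
  {c | ∃ A : MVAlg.{u}, Nat.card A.carrier = n ∧ P A ∧ Quotient.mk isoSetoid A = c}

end MVAlg

/-- The non-trivial unordered decompositions of `n`: multisets of at least two integers
greater than `1` whose product is `n`. -/
def properDecompositions (n : ℕ) : Set (Multiset ℕ) :=
  {s | 2 ≤ Multiset.card s ∧ (∀ a ∈ s, 1 < a) ∧ s.prod = n}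

/-- `π(n)`, the number of non-trivial unordered decompositions of `n` into factors `> 1`
(there are finitely many for `n ≥ 1`). -/
noncomputable def numDecompositions (n : ℕ) : ℕ :=
  (properDecompositions n).ncard

-- Write 1 for 0* and x ⊖ y for (x* ⊕ y)*. An idempotent e other than 0 and 1 splits a finite
-- MV-algebra: x ↦ (x ⊕ e, x ⊕ e*) is an isomorphism onto [e, 1] × [e*, 1] (`toUpper_injective`,
-- `exists_add_eq_and_add_neg_eq`), and both factors are smaller. Without such an idempotent the
-- algebra is a chain (`isMVChain_of_idempotent_trivial`), and a finite non-trivial chain consists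
-- of the multiples of its least nonzero element, hence is some `Luk m`. By induction on
-- cardinality, every finite MV-algebra is a product of chains `Luk m`.
--
-- The factors are determined by the product: its atoms correspond to the coordinates, and the
-- number of steps after which the multiples of an atom become stationary recovers m
-- (`card_fiber_eq_of_iso`). Isomorphism classes of size n thus correspond to multisets of integers
-- > 1 with product n, and the chains to `{n}` alone.

universe w

namespace MVAlgebra

/-! ### Natural order, stationary multiples and idempotents. -/

section Basic

variable {M : Type u} [MVAlgebra M]

theorem neg_neg (x : M) : neg (neg x) = x := neg_neg' x

theorem add_one (x : M) : x + neg 0 = neg 0 := add_neg_zero' x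

theorem one_add (x : M) : neg 0 + x = neg 0 := by rw [add_comm, add_one]

theorem neg_add_self (x : M) : neg x + x = neg 0 := by
  have h := luk' x (neg 0)
  rw [add_one, neg_neg, zero_add] at h
  exact h.symm

theorem add_neg_self (x : M) : x + neg x = neg 0 := by rw [add_comm, neg_add_self]

theorem neg_injective : Function.Injective (neg : M → M) :=
  Function.LeftInverse.injective (g := neg) neg_neg

theorem le_add_right (x z : M) : le x (x + z) := by
  rw [le, ← add_assoc, neg_add_self, one_add]

theorem neg_sub_add_cancel {x y : M} (h : le x y) : neg (neg y + x) + x = y := by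
  rw [← luk' x y, show neg x + y = neg 0 from h, neg_neg, zero_add]

theorem le_iff_exists_add {x y : M} : le x y ↔ ∃ c, y = x + c := by
  constructor
  · intro h
    exact ⟨neg (neg y + x), by rw [add_comm, neg_sub_add_cancel h]⟩
  · rintro ⟨c, rfl⟩
    exact le_add_right x c

theorem le_refl (x : M) : le x x := neg_add_self x

theorem le_antisymm {x y : M} (hxy : le x y) (hyx : le y x) : x = y := by
  have h := neg_sub_add_cancel hxy
  rw [show neg y + x = neg 0 from hyx, neg_neg, zero_add] at h
  exact h

theorem le_trans {x y z : M} (hxy : le x y) (hyz : le y z) : le x z := by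
  obtain ⟨c, rfl⟩ := le_iff_exists_add.1 hxy
  obtain ⟨d, rfl⟩ := le_iff_exists_add.1 hyz
  rw [add_assoc]
  exact le_add_right _ _

theorem add_le_add_right {x y : M} (h : le x y) (z : M) : le (x + z) (y + z) := by
  obtain ⟨c, rfl⟩ := le_iff_exists_add.1 h
  rw [add_right_comm]
  exact le_add_right _ _

theorem zero_le (x : M) : le 0 x := one_add x

theorem eq_one_of_one_le {x : M} (h : le (neg 0) x) : x = neg 0 := by
  rw [le, neg_neg, zero_add] at h
  exact h

theorem zero_ne_one [Nontrivial M] : (0 : M) ≠ neg 0 := by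
  intro h
  obtain ⟨x, y, hxy⟩ := exists_pair_ne M
  apply hxy
  rw [← add_zero x, ← add_zero y, h, add_one, add_one]

theorem nsmul_le_nsmul_left (a : M) {i j : ℕ} (h : i ≤ j) : le (i • a) (j • a) := by
  obtain ⟨k, rfl⟩ := Nat.exists_eq_add_of_le h
  rw [add_nsmul]
  exact le_add_right _ _

theorem nsmul_add_self_of_eq {a : M} {i j : ℕ} (hij : i < j) (h : i • a = j • a) :
    i • a + a = i • a := by
  apply le_antisymm _ (le_add_right _ _)
  have h' := nsmul_le_nsmul_left a (Nat.succ_le_of_lt hij)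
  rwa [succ_nsmul, ← h] at h'

theorem exists_nsmul_add_self [Finite M] (a : M) : ∃ i : ℕ, i • a + a = i • a := by
  obtain ⟨i, j, hij, h⟩ := Finite.exists_ne_map_eq_of_infinite (fun k : ℕ => k • a)
  rcases lt_or_gt_of_ne hij with hlt | hlt
  · exact ⟨i, nsmul_add_self_of_eq hlt h⟩
  · exact ⟨j, nsmul_add_self_of_eq hlt h.symm⟩

theorem add_nsmul_of_add_eq {a b : M} (h : b + a = b) (k : ℕ) : b + k • a = b := by
  induction k with
  | zero => rw [zero_nsmul, add_zero]
  | succ k ih => rw [succ_nsmul, ← add_assoc, ih, h]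

/-- The elements `x ⊖ y` and `y ⊖ x` are disjoint. -/
theorem sub_add_neg_sub (x y : M) :
    neg (neg x + y) + (neg y + x) = neg y + x := by
  -- Both sides of `h2` are the meet of x and y. Adding y* to it gives y* ⊕ x (`h1`); adding x ⊖ y
  -- gives x (`h3`).
  have h1 : neg (neg (neg y + x) + neg y) + neg y = neg y + x := by
    have h := neg_sub_add_cancel (le_add_right (neg y) x)
    exact h
  have h2 : neg (neg (neg y + x) + neg y) = neg (neg (neg x + y) + neg x) := by
    have h := luk' (neg x) (neg y)
    rw [neg_neg, neg_neg] at h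
    rw [add_comm (neg y) x, h, add_comm y]
  have h3 : neg (neg (neg x + y) + neg x) + neg (neg x + y) = x := by
    have h : le (neg (neg x + y)) x := by
      rw [le, neg_neg, add_right_comm, neg_add_self, one_add]
    rw [add_comm (neg (neg x + y)) (neg x)]
    exact neg_sub_add_cancel h
  calc neg (neg x + y) + (neg y + x)
      = neg (neg x + y) + (neg (neg (neg x + y) + neg x) + neg y) := by rw [← h2, h1]
    _ = (neg (neg (neg x + y) + neg x) + neg (neg x + y)) + neg y := by
        rw [← add_assoc, add_comm (neg (neg x + y))]
    _ = neg y + x := by rw [h3, add_comm]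

/-- If x ⊖ y ≠ 0, its stationary multiple is a nonzero idempotent, hence 1. Since y* ⊕ x absorbs x ⊖
y, it absorbs 1, so y ≤ x. -/
theorem isMVChain_of_idempotent_trivial [Finite M]
    (h : ∀ e : M, e + e = e → e = 0 ∨ e = neg 0) : IsMVChain M := by
  intro x y
  by_cases ha : neg (neg x + y) = 0
  · left
    rw [le, ← ha, neg_neg]
  · right
    obtain ⟨i, hi⟩ := exists_nsmul_add_self (neg (neg x + y))
    have hone : i • neg (neg x + y) = neg 0 := by
      refine (h _ (add_nsmul_of_add_eq hi i)).resolve_left fun h0 => ha ?_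
      rwa [h0, zero_add] at hi
    have hd : neg y + x + neg (neg x + y) = neg y + x := by
      rw [add_comm, sub_add_neg_sub]
    have := add_nsmul_of_add_eq hd i
    rw [hone, add_one] at this
    exact this.symm

/-- Adding an idempotent is the same as taking the join with it. -/
theorem add_idempotent_eq_join {e : M} (he : e + e = e) (a : M) :
    neg (neg a + e) + e = a + e := by
  apply le_antisymm
  · apply add_le_add_right
    rw [le, neg_neg, add_right_comm, neg_add_self, one_add]
  · have h1 : neg (neg a + e) + e = a + neg (neg e + a) + e := by
      rw [add_comm a, ← luk' a e, add_assoc, he]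
    rw [h1, add_right_comm]
    exact le_add_right _ _

end Basic
end MVAlgebra

namespace MVAlgebra

/-! ### Principal filters of idempotents. -/

section Upper

variable {M : Type u} [MVAlgebra M]

/-- The principal filter `[e, 1]` of an idempotent `e`, as the set of `x` with `x ⊕ e = x`. -/
def Upper (e : M) : Type u := {x : M // x + e = x}

/-- `[e, 1]` is an MV-algebra with zero `e` and negation
`x ↦ x* ⊕ e`, for an idempotent `e`. -/
@[reducible]
def upperMVAlgebra {e : M} (he : e + e = e) : MVAlgebra (Upper e) where
  add x y := ⟨x.1 + y.1, by rw [add_assoc, y.2]⟩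
  zero := ⟨e, he⟩
  nsmul := @nsmulRec _ ⟨⟨e, he⟩⟩ ⟨fun x y => ⟨x.1 + y.1, by rw [add_assoc, y.2]⟩⟩
  add_assoc x y z := Subtype.ext (add_assoc _ _ _)
  zero_add x := Subtype.ext ((add_comm _ _).trans x.2)
  add_zero x := Subtype.ext x.2
  add_comm x y := Subtype.ext (add_comm _ _)
  neg x := ⟨neg x.1 + e, by rw [add_assoc, he]⟩
  neg_neg' x := by
    apply Subtype.ext
    change neg (neg x.1 + e) + e = x.1
    rw [add_idempotent_eq_join he, x.2]
  add_neg_zero' x := by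
    apply Subtype.ext
    change x.1 + (neg e + e) = neg e + e
    rw [neg_add_self, add_one]
  luk' x y := by
    apply Subtype.ext
    change neg (neg x.1 + e + y.1) + e + y.1 = neg (neg y.1 + e + x.1) + e + x.1
    rw [add_assoc (neg x.1), add_assoc (neg y.1), add_assoc _ e y.1, add_assoc _ e x.1,
      add_comm e, add_comm e, x.2, y.2, luk']

theorem neg_idempotent_add {e : M} (he : e + e = e) : neg e + neg e = neg e := by
  have h := add_idempotent_eq_join he (neg e)
  rw [luk', neg_add_self] at h
  exact le_antisymm h (le_add_right _ _)

theorem neg_add_idempotent {e : M} (he : e + e = e) (x : M) :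
    neg (x + e) + e = neg x + e := by
  have h := add_idempotent_eq_join he (neg x)
  rwa [neg_neg] at h

/-- For z = x* ⊕ y the hypotheses say z ⊕ e = z ⊕ e* = 1. The join of z and e is z ⊕ e = 1, while
MV3 and z ⊕ e* = 1 reduce it to z. -/
theorem le_of_add_idempotent_le {e x y : M} (he : e + e = e) (h : le x (y + e))
    (h' : le x (y + neg e)) : le x y := by
  rw [le, ← add_assoc] at h h'
  have h1 := add_idempotent_eq_join he (neg x + y)
  rw [luk', add_comm (neg e), h', h, neg_neg, zero_add] at h1
  exact h1

end Upper

/-! ### Isomorphisms. -/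

section Transport

variable {M : Type u} {N : Type v} {P : Type w} [MVAlgebra M] [MVAlgebra N] [MVAlgebra P]

namespace Iso

theorem map_neg (e : Iso M N) (x : M) : e.toAddEquiv (neg x) = neg (e.toAddEquiv x) :=
  e.map_neg' x

/-- A bijective homomorphism is an isomorphism. -/
noncomputable def ofBijective (f : M → N) (hf : Function.Bijective f)
    (hadd : ∀ x y, f (x + y) = f x + f y) (hneg : ∀ x, f (neg x) = neg (f x)) : Iso M N where
  toEquiv := Equiv.ofBijective f hf
  map_add' := hadd
  map_neg' := hneg

noncomputable def symm (e : Iso M N) : Iso N M :=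
  ofBijective e.toAddEquiv.symm e.toAddEquiv.symm.bijective (map_add _) fun y => by
    apply e.toAddEquiv.injective
    rw [e.map_neg]
    simp

noncomputable def trans (e : Iso M N) (f : Iso N P) : Iso M P :=
  ofBijective (fun x => f.toAddEquiv (e.toAddEquiv x))
    (f.toAddEquiv.bijective.comp e.toAddEquiv.bijective) (by simp)
    (fun x => by rw [e.map_neg, f.map_neg])

theorem le_iff (e : Iso M N) (x y : M) :
    le (e.toAddEquiv x) (e.toAddEquiv y) ↔ le x y := by
  rw [le, le, ← e.map_neg, ← map_add, ← map_zero e.toAddEquiv, ← e.map_neg,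
    e.toAddEquiv.injective.eq_iff]

theorem isMVChain (e : Iso M N) (h : IsMVChain M) : IsMVChain N := by
  intro x y
  rw [← e.symm.le_iff, ← e.symm.le_iff]
  exact h _ _

end Iso

/-- Reindexing a product along a bijection of the index sets. -/
noncomputable def Iso.piCongrLeft {ι κ : Type*} (C : κ → Type v) [∀ i, MVAlgebra (C i)]
    (σ : ι ≃ κ) : Iso (∀ j, C j) (∀ i, C (σ i)) :=
  Iso.ofBijective (fun x i => x (σ i)) (Equiv.piCongrLeft C σ).symm.bijective
    (fun _ _ => rfl) (fun _ => rfl)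

end Transport

/-- The finite Łukasiewicz chain with elements `0, …, m`. -/
@[ext]
structure Luk (m : ℕ) : Type u where
  val : ℕ
  val_le : val ≤ m

namespace Luk

variable {m : ℕ}

instance : Zero (Luk.{u} m) := ⟨⟨0, Nat.zero_le _⟩⟩

instance : Add (Luk.{u} m) := ⟨fun x y => ⟨min (x.val + y.val) m, min_le_right _ _⟩⟩

instance : MVAlgebra (Luk.{u} m) where
  nsmul := nsmulRec
  add_assoc x y z := by
    apply Luk.ext
    change min (min (x.val + y.val) m + z.val) m = min (x.val + min (y.val + z.val) m) m
    omega
  zero_add x := by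
    apply Luk.ext
    change min (0 + x.val) m = x.val
    have := x.val_le
    omega
  add_zero x := by
    apply Luk.ext
    change min (x.val + 0) m = x.val
    have := x.val_le
    omega
  add_comm x y := by
    apply Luk.ext
    change min (x.val + y.val) m = min (y.val + x.val) m
    omega
  neg x := ⟨m - x.val, Nat.sub_le _ _⟩
  neg_neg' x := by
    apply Luk.ext
    change m - (m - x.val) = x.val
    have := x.val_le
    omega
  add_neg_zero' x := by
    apply Luk.ext
    change min (x.val + (m - 0)) m = m - 0
    omega
  luk' x y := by
    apply Luk.ext
    change min (m - (min (m - x.val + y.val) m) + y.val) m =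
      min (m - (min (m - y.val + x.val) m) + x.val) m
    have := x.val_le
    have := y.val_le
    omega

theorem val_add (x y : Luk.{u} m) : (x + y).val = min (x.val + y.val) m := rfl

theorem val_zero : (0 : Luk.{u} m).val = 0 := rfl

theorem val_neg (x : Luk.{u} m) : (neg x).val = m - x.val := rfl

theorem val_nsmul (j : ℕ) (x : Luk.{u} m) : (j • x).val = min (j * x.val) m := by
  induction j with
  | zero => simp [val_zero]
  | succ j ih => rw [succ_nsmul, val_add, ih, Nat.succ_mul]; omega

theorem le_iff {x y : Luk.{u} m} : le x y ↔ x.val ≤ y.val := by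
  rw [le, Luk.ext_iff, val_add, val_neg, val_neg, val_zero]
  have := x.val_le
  have := y.val_le
  omega

theorem isMVChain : IsMVChain (Luk.{u} m) := fun x y => by
  rw [le_iff, le_iff]
  exact Nat.le_total _ _

/-- The underlying type of the chain is `Fin (m + 1)`. -/
def equivFin : Luk.{u} m ≃ Fin (m + 1) where
  toFun x := ⟨x.val, Nat.lt_succ_of_le x.val_le⟩
  invFun i := ⟨i, Nat.le_of_lt_succ i.2⟩

instance : Finite (Luk.{u} m) := Finite.of_equiv _ equivFin.symm

theorem card_eq : Nat.card (Luk.{u} m) = m + 1 := by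
  rw [Nat.card_congr equivFin, Nat.card_fin]

theorem nontrivial (hm : 1 ≤ m) : Nontrivial (Luk.{u} m) :=
  ⟨⟨0, by omega⟩, ⟨1, hm⟩, fun h => by simpa using congrArg val h⟩

end Luk

/-! ### Classification of finite chains. -/

section Chain

variable {M : Type u} [MVAlgebra M]

/-- MV3 for a* and x: if x absorbed a, one side would be x* ⊕ x = 1 and the other a*, forcing a = 0.
-/
theorem add_ne_self {a x : M} (ha : a ≠ 0) (h : le a (neg x)) : x + a ≠ x := by
  intro hx
  have h2 := luk' (neg a) x
  rw [neg_neg, add_comm a, hx, neg_add_self, add_comm (neg x), show neg a + neg x = neg 0 from h,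
    neg_neg, zero_add] at h2
  exact ha (neg_injective h2.symm)

theorem exists_least_ne_zero [Finite M] [Nontrivial M] (h : IsMVChain M) :
    ∃ a : M, a ≠ 0 ∧ ∀ x : M, x ≠ 0 → le a x := by
  let _ : PartialOrder M :=
    { le := le
      le_refl := le_refl
      le_trans := fun _ _ _ => le_trans
      le_antisymm := fun _ _ => le_antisymm }
  obtain ⟨a, ha⟩ := Set.Finite.exists_minimal (Set.toFinite {x : M | x ≠ 0}) (exists_ne 0)
  refine ⟨a, ha.1, fun x hx => ?_⟩
  rcases h a x with h | h
  · exact h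
  · exact ha.2 hx h

/-- A finite non-trivial MV-chain is a Łukasiewicz chain. -/
theorem exists_iso_luk_of_isMVChain [Finite M] [Nontrivial M] (h : IsMVChain M) :
    ∃ m : ℕ, 1 ≤ m ∧ Nonempty (Iso M (Luk.{u} m)) := by
  obtain ⟨a, ha, hmin⟩ := exists_least_ne_zero h
  -- If x ≠ 1 then x* ≠ 0, so a ≤ x* by minimality; hence the multiples of a grow strictly until
  -- they reach 1.
  have hadd : ∀ x : M, x + a = x → x = neg 0 := by
    intro x hx
    by_contra hne
    refine add_ne_self ha (hmin _ fun h0 => hne ?_) hx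
    rw [← h0, neg_neg]
  have hex : ∃ k : ℕ, k • a = neg 0 := by
    obtain ⟨i, hi⟩ := exists_nsmul_add_self a
    exact ⟨i, hadd _ hi⟩
  classical
  obtain ⟨m, hm, hlt⟩ : ∃ m : ℕ, m • a = neg 0 ∧ ∀ k < m, k • a ≠ neg 0 :=
    ⟨Nat.find hex, Nat.find_spec hex, fun k hk => Nat.find_min hex hk⟩
  have hge : ∀ k, m ≤ k → k • a = neg 0 := by
    intro k hk
    have := nsmul_le_nsmul_left a hk
    rw [hm] at this
    exact eq_one_of_one_le this
  have hinj' : ∀ i j : ℕ, i < j → i • a = j • a → m ≤ i := by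
    intro i j hij heq
    by_contra hi
    exact hlt i (by omega) (hadd _ (nsmul_add_self_of_eq hij heq))
  have hle : ∀ i j : ℕ, i ≤ m → le (i • a) (j • a) → i ≤ j := by
    intro i j hi hij
    by_contra hji
    have := hinj' j i (by omega) (le_antisymm (nsmul_le_nsmul_left a (by omega)) hij)
    omega
  have hsurj : ∀ y : M, ∃ k ≤ m, k • a = y := by
    intro y
    by_contra! hne
    -- If y = k • a ⊕ d is not a multiple of a, then d ≠ 0, so d ≥ a and y ≥ (k + 1) • a. At k = m
    -- this forces y = 1 = m • a, a contradiction.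
    have hall : ∀ k ≤ m, le (k • a) y := by
      intro k
      induction k with
      | zero => intro _; rw [zero_nsmul]; exact zero_le y
      | succ k ih =>
        intro hk
        obtain ⟨d, rfl⟩ := le_iff_exists_add.1 (ih (by omega))
        have hd : d ≠ 0 := by
          rintro rfl
          exact hne k (by omega) (add_zero _).symm
        obtain ⟨c, rfl⟩ := le_iff_exists_add.1 (hmin d hd)
        rw [succ_nsmul, ← add_assoc]
        exact le_add_right _ _
    refine hne m le_rfl ?_
    have := hall m le_rfl
    rw [hm] at this ⊢
    exact (eq_one_of_one_le this).symm
  refine ⟨m, Nat.one_le_iff_ne_zero.2 fun h0 => ?_, ⟨Iso.symm ?_⟩⟩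
  · rw [h0, zero_nsmul] at hm
    exact zero_ne_one hm
  · refine Iso.ofBijective (fun k => k.val • a) ⟨fun i j hij => ?_, fun y => ?_⟩
      (fun i j => ?_) (fun i => ?_)
    · apply Luk.ext
      have hij : i.val • a = j.val • a := hij
      exact Nat.le_antisymm (hle _ _ i.val_le (hij ▸ le_refl _))
        (hle _ _ j.val_le (hij ▸ le_refl _))
    · obtain ⟨k, hk, rfl⟩ := hsurj y
      exact ⟨⟨k, hk⟩, rfl⟩
    · change min (i.val + j.val) m • a = i.val • a + j.val • a
      rw [← add_nsmul]
      rcases Nat.le_total (i.val + j.val) m with hc | hc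
      · rw [min_eq_left hc]
      · rw [min_eq_right hc, hm, hge _ hc]
    · change (m - i.val) • a = neg (i.val • a)
      have hi := i.val_le
      obtain ⟨j, hj, hja⟩ := hsurj (neg (i.val • a))
      have h1 : m ≤ i.val + j := by
        by_contra hlt'
        apply hlt (i.val + j) (by omega)
        rw [add_nsmul, hja, add_neg_self]
      have h2 : j ≤ m - i.val := by
        apply hle _ _ hj
        rw [hja, le, neg_neg, ← add_nsmul, Nat.add_sub_cancel' hi, hm]
      rw [← hja]
      congr 1
      omega

end Chain

end MVAlgebra

namespace MVAlgebra

/-! ### Splitting along an idempotent. -/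

section Decomposition

variable {M : Type u} [MVAlgebra M]

theorem card_upper_lt [Finite M] {e : M} (he : e ≠ 0) : Nat.card (Upper e) < Nat.card M :=
  Finite.card_subtype_lt (x := (0 : M)) (by rwa [zero_add])

instance [Finite M] (e : M) : Finite (Upper e) := Subtype.finite

/-- The projection `x ↦ x ⊕ e` onto `[e, 1]`. -/
def toUpper {e : M} (he : e + e = e) (x : M) : Upper e := ⟨x + e, by rw [add_assoc, he]⟩

theorem toUpper_injective {e : M} (he : e + e = e) {x y : M}
    (h : toUpper he x = toUpper he y)
    (h' : toUpper (neg_idempotent_add he) x = toUpper (neg_idempotent_add he) y) : x = y := by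
  have h1 : x + e = y + e := congrArg Subtype.val h
  have h2 : x + neg e = y + neg e := congrArg Subtype.val h'
  apply le_antisymm <;> apply le_of_add_idempotent_le he
  · exact h1 ▸ le_add_right _ _
  · exact h2 ▸ le_add_right _ _
  · exact h1 ▸ le_add_right _ _
  · exact h2 ▸ le_add_right _ _

theorem exists_add_eq_and_add_neg_eq {e : M} (he : e + e = e) {a b : M} (ha : a + e = a)
    (hb : b + neg e = b) : ∃ x : M, x + e = a ∧ x + neg e = b := by
  -- The witness is (a ⊖ e) ⊕ (b ⊖ e*). Since b ⊖ e* ≤ e, adding e absorbs that term and leaves the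
  -- join of a and e, which is a; the roles of (e, a) and (e*, b) are symmetric.
  have key : ∀ {e a b : M}, e + e = e → a + e = a → b + neg e = b →
      neg (neg a + e) + neg (neg b + neg e) + e = a := by
    intro e a b he ha hb
    have h1 : le (neg (neg b + neg e)) e := by
      rw [le, neg_neg, add_assoc, neg_add_self, add_one]
    have h2 : neg (neg b + neg e) + e = e := by
      refine le_antisymm ?_ (add_comm e _ ▸ le_add_right _ _)
      have := add_le_add_right h1 e
      rwa [he] at this
    rw [add_assoc, h2, add_idempotent_eq_join he, ha]
  refine ⟨neg (neg a + e) + neg (neg b + neg e), key he ha hb, ?_⟩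
  have := key (e := neg e) (a := b) (b := a) (neg_idempotent_add he) hb (by rwa [neg_neg])
  rwa [neg_neg, add_comm (neg (neg b + neg e))] at this

/-- Every finite MV-algebra is a product of finite Łukasiewicz chains. -/
theorem exists_iso_pi_luk (M : Type u) [MVAlgebra M] [Finite M] :
    ∃ (ι : Type) (_ : Fintype ι) (m : ι → ℕ), (∀ i, 1 ≤ m i) ∧
      Nonempty (Iso M (∀ i, Luk.{u} (m i))) := by
  induction hn : Nat.card M using Nat.strong_induction_on generalizing M with
  | _ n ih =>
  subst hn
  by_cases hsub : Subsingleton M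
  -- The one-element algebra is the empty product.
  · refine ⟨Empty, inferInstance, fun _ => 1, fun _ => le_rfl, ⟨Iso.ofBijective
      (fun _ i => i.elim) ⟨fun x y _ => Subsingleton.elim x y, fun y => ⟨0, Subsingleton.elim _ _⟩⟩
      (fun _ _ => Subsingleton.elim _ _) (fun _ => Subsingleton.elim _ _)⟩⟩
  rw [not_subsingleton_iff_nontrivial] at hsub
  by_cases hch : IsMVChain M
  · obtain ⟨m, hm, ⟨f⟩⟩ := exists_iso_luk_of_isMVChain hch
    refine ⟨Unit, inferInstance, fun _ => m, fun _ => hm, ⟨f.trans (Iso.ofBijective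
      (fun x _ => x) ⟨fun x y h => congrFun h (), fun y => ⟨y (), rfl⟩⟩
      (fun _ _ => rfl) (fun _ => rfl))⟩⟩
  obtain ⟨e, he, he0, he1⟩ : ∃ e : M, e + e = e ∧ e ≠ 0 ∧ e ≠ neg 0 := by
    by_contra! hcon
    refine hch (isMVChain_of_idempotent_trivial fun e he => ?_)
    by_contra! h
    exact h.2 (hcon e he h.1)
  have hf0 : neg e ≠ 0 := fun h => he1 (by rw [← h, neg_neg])
  have hf := neg_idempotent_add he
  let _ := upperMVAlgebra he
  let _ := upperMVAlgebra hf
  obtain ⟨ι, _, m, hm, ⟨f⟩⟩ := ih _ (card_upper_lt he0) (Upper e) rfl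
  obtain ⟨κ, _, l, hl, ⟨g⟩⟩ := ih _ (card_upper_lt hf0) (Upper (neg e)) rfl
  refine ⟨ι ⊕ κ, inferInstance, Sum.elim m l, by rintro (i | j) <;> simp [hm, hl],
    ⟨Iso.ofBijective (fun x => Sum.rec (f.toAddEquiv (toUpper he x))
      (g.toAddEquiv (toUpper hf x))) ⟨fun x y h => ?_, fun y => ?_⟩ (fun x y => ?_)
      (fun x => ?_)⟩⟩
  · apply toUpper_injective he
    · apply f.toAddEquiv.injective
      funext i
      exact congrFun h (Sum.inl i)
    · apply g.toAddEquiv.injective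
      funext i
      exact congrFun h (Sum.inr i)
  · obtain ⟨a, ha⟩ := f.toAddEquiv.surjective fun i => y (Sum.inl i)
    obtain ⟨b, hb⟩ := g.toAddEquiv.surjective fun i => y (Sum.inr i)
    obtain ⟨x, hxa, hxb⟩ := exists_add_eq_and_add_neg_eq he a.2 b.2
    have h1 : toUpper he x = a := Subtype.ext hxa
    have h2 : toUpper hf x = b := Subtype.ext hxb
    refine ⟨x, funext ?_⟩
    rintro (i | j)
    · change f.toAddEquiv (toUpper he x) i = _
      rw [h1, ha]
    · change g.toAddEquiv (toUpper hf x) j = _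
      rw [h2, hb]
  · have hadd : ∀ {e : M} (he : e + e = e), (x + y) + e = (x + e) + (y + e) := by
      intro e he
      rw [add_add_add_comm, he]
    have h1 : toUpper he (x + y) = toUpper he x + toUpper he y := Subtype.ext (hadd he)
    have h2 : toUpper hf (x + y) = toUpper hf x + toUpper hf y := Subtype.ext (hadd hf)
    funext i
    rcases i with i | j
    · change f.toAddEquiv _ i = f.toAddEquiv _ i + f.toAddEquiv _ i
      rw [h1, map_add]
      rfl
    · change g.toAddEquiv _ j = g.toAddEquiv _ j + g.toAddEquiv _ j
      rw [h2, map_add]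
      rfl
  · have h1 : toUpper he (neg x) = neg (toUpper he x) :=
      Subtype.ext (neg_add_idempotent he x).symm
    have h2 : toUpper hf (neg x) = neg (toUpper hf x) :=
      Subtype.ext (neg_add_idempotent hf x).symm
    funext i
    rcases i with i | j
    · change f.toAddEquiv _ i = neg (f.toAddEquiv _ i)
      rw [h1, f.map_neg]
      rfl
    · change g.toAddEquiv _ j = neg (g.toAddEquiv _ j)
      rw [h2, g.map_neg]
      rfl

/-- The indicators of two distinct coordinates are incomparable. -/
theorem not_isMVChain_pi {ι : Type v} (C : ι → Type u) [∀ i, MVAlgebra (C i)]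
    [∀ i, Nontrivial (C i)] {i j : ι} (hij : i ≠ j) : ¬ IsMVChain (∀ i, C i) := by
  classical
  intro h
  have key : ∀ i j, i ≠ j → ¬ le (fun k => if k = i then neg (0 : C k) else 0)
      (fun k => if k = j then neg (0 : C k) else 0) := by
    intro i j hij hle
    have hi : neg (if i = i then neg (0 : C i) else 0) + (if i = j then neg (0 : C i) else 0) =
      neg (0 : C i) := congrFun hle i
    rw [if_pos rfl, if_neg hij, neg_neg, zero_add] at hi
    exact zero_ne_one hi
  exact (h _ _).elim (key i j hij) (key j i hij.symm)

end Decomposition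

/-! ### Recovering the factors from the atoms. -/

section Uniqueness

/-- `a` is an atom whose multiples become stationary exactly from the `k`-th one on. -/
def IsAtomOfHeight {M : Type u} [MVAlgebra M] (k : ℕ) (a : M) : Prop :=
  a ≠ 0 ∧ (∀ x, le x a → x = 0 ∨ x = a) ∧ ∀ j : ℕ, j • a + a = j • a ↔ k ≤ j

theorem Iso.isAtomOfHeight_iff {M : Type u} {N : Type v} [MVAlgebra M] [MVAlgebra N]
    (e : Iso M N) (k : ℕ) (a : M) : IsAtomOfHeight k (e.toAddEquiv a) ↔ IsAtomOfHeight k a := by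
  unfold IsAtomOfHeight
  refine and_congr ?_ (and_congr ?_ (forall_congr' fun j => iff_congr ?_ Iff.rfl))
  · simp
  · rw [e.toAddEquiv.surjective.forall]
    simp [e.le_iff, -EquivLike.coe_coe]
  · rw [← map_nsmul, ← map_add, e.toAddEquiv.injective.eq_iff]

variable {ι : Type v} {m : ι → ℕ}

open Classical in
/-- The atom of a product of Łukasiewicz chains in the coordinate `i`. -/
noncomputable def lukAtom (hm : ∀ i, 1 ≤ m i) (i : ι) : ∀ j, Luk.{u} (m j) :=
  fun j => if j = i then ⟨1, hm j⟩ else 0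

theorem val_lukAtom_self (hm : ∀ i, 1 ≤ m i) (i : ι) : (lukAtom.{u} hm i i).val = 1 := by
  rw [lukAtom, if_pos rfl]

theorem val_lukAtom_of_ne (hm : ∀ i, 1 ≤ m i) {i j : ι} (h : j ≠ i) :
    (lukAtom.{u} hm i j).val = 0 := by
  rw [lukAtom, if_neg h, Luk.val_zero]

theorem pi_le_iff {C : ι → Type u} [∀ i, MVAlgebra (C i)] {x y : ∀ i, C i} :
    le x y ↔ ∀ i, le (x i) (y i) := funext_iff

theorem isAtomOfHeight_lukAtom (hm : ∀ i, 1 ≤ m i) (i : ι) :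
    IsAtomOfHeight (m i) (lukAtom.{u} hm i) := by
  refine ⟨fun h => ?_, fun x hx => ?_, fun j => ?_⟩
  · have := congrArg Luk.val (congrFun h i)
    rw [val_lukAtom_self] at this
    exact one_ne_zero this
  · rw [pi_le_iff] at hx
    have hi := Luk.le_iff.1 (hx i)
    rw [val_lukAtom_self] at hi
    have hne : ∀ j, j ≠ i → (x j).val = 0 := by
      intro j hj
      have h := Luk.le_iff.1 (hx j)
      rw [val_lukAtom_of_ne hm hj] at h
      omega
    rcases Nat.le_one_iff_eq_zero_or_eq_one.1 hi with h | h
    · left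
      funext j
      apply Luk.ext
      by_cases hj : j = i
      · subst hj; exact h
      · exact hne j hj
    · right
      funext j
      apply Luk.ext
      by_cases hj : j = i
      · subst hj; rw [h, val_lukAtom_self]
      · rw [hne j hj, val_lukAtom_of_ne hm hj]
  · have hval : ∀ k, ((j • lukAtom.{u} hm i + lukAtom hm i) k).val =
        (min (min (j * (lukAtom.{u} hm i k).val) (m k) + (lukAtom.{u} hm i k).val) (m k)) := by
      intro k
      rw [← Luk.val_nsmul]
      rfl
    have hval' : ∀ k, ((j • lukAtom.{u} hm i) k).val =
        min (j * (lukAtom.{u} hm i k).val) (m k) := fun k => by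
      rw [← Luk.val_nsmul]
      rfl
    constructor
    · intro h
      have := congrArg Luk.val (congrFun h i)
      rw [hval, hval', val_lukAtom_self] at this
      omega
    · intro h
      funext k
      apply Luk.ext
      rw [hval, hval']
      by_cases hk : k = i
      · subst hk
        rw [val_lukAtom_self]
        omega
      · rw [val_lukAtom_of_ne hm hk]
        omega

/-- A nonzero a dominates the atom of any coordinate in which it does not vanish, so an atom a
equals it; the stationarity condition then fixes the height. -/
theorem exists_eq_lukAtom (hm : ∀ i, 1 ≤ m i) {k : ℕ} {a : ∀ j, Luk.{u} (m j)}
    (ha : IsAtomOfHeight k a) : ∃ i, m i = k ∧ lukAtom hm i = a := by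
  obtain ⟨i, hi⟩ : ∃ i, a i ≠ 0 := Function.ne_iff.1 ha.1
  have hle : le (lukAtom hm i) a := by
    rw [pi_le_iff]
    intro j
    rw [Luk.le_iff]
    by_cases hj : j = i
    · subst hj
      rw [val_lukAtom_self, Nat.one_le_iff_ne_zero]
      exact fun h => hi (Luk.ext h)
    · rw [val_lukAtom_of_ne hm hj]
      exact Nat.zero_le _
  have hatom := isAtomOfHeight_lukAtom.{u} hm i
  obtain rfl := (ha.2.1 _ hle).resolve_left hatom.1
  refine ⟨i, Nat.le_antisymm ((hatom.2.2 k).1 ((ha.2.2 k).2 le_rfl))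
    ((ha.2.2 (m i)).1 ((hatom.2.2 (m i)).2 le_rfl)), rfl⟩

/-- The factors equal to the chain with `k + 1` elements correspond to the atoms of height `k`. -/
theorem card_fiber_eq (hm : ∀ i, 1 ≤ m i) (k : ℕ) :
    Nat.card {i // m i = k} = Nat.card {a : ∀ j, Luk.{u} (m j) // IsAtomOfHeight k a} := by
  refine Nat.card_congr (Equiv.ofBijective
    (fun i => ⟨lukAtom hm i.1, by
      obtain ⟨i, rfl⟩ := i
      exact isAtomOfHeight_lukAtom hm i⟩) ⟨fun i j h => ?_, fun a => ?_⟩)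
  · apply Subtype.ext
    by_contra hne
    have := congrArg Luk.val (congrFun (congrArg Subtype.val h) i.1)
    rw [val_lukAtom_self, val_lukAtom_of_ne hm hne] at this
    exact one_ne_zero this
  · obtain ⟨i, hi, h⟩ := exists_eq_lukAtom hm a.2
    exact ⟨⟨i, hi⟩, Subtype.ext h⟩

/-- Two finite products of non-trivial Łukasiewicz chains are isomorphic only if they have the
same factors. -/
theorem card_fiber_eq_of_iso {κ : Type w} {l : κ → ℕ} (hm : ∀ i, 1 ≤ m i) (hl : ∀ i, 1 ≤ l i)
    (e : Iso (∀ i, Luk.{u} (m i)) (∀ i, Luk.{u} (l i))) (k : ℕ) :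
    Nat.card {i // m i = k} = Nat.card {i // l i = k} := by
  rw [card_fiber_eq.{u} hm, card_fiber_eq.{u} hl]
  exact Nat.card_congr (e.toAddEquiv.toEquiv.subtypeEquiv fun a => (e.isAtomOfHeight_iff k a).symm)

end Uniqueness

end MVAlgebra

/-! ### Families up to reindexing as multisets. -/

theorem card_fiber_eq_count {ι α : Type*} [Fintype ι] [DecidableEq α] (f : ι → α) (a : α) :
    Nat.card {i // f i = a} = (Finset.univ.val.map f).count a := by
  rw [Multiset.count_map, Nat.card_eq_fintype_card, Fintype.card_subtype]
  simp only [eq_comm]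
  rfl

theorem univ_map_toList_get {α β : Type*} (s : Multiset α) (f : α → β) :
    (Finset.univ.val.map fun i : Fin s.toList.length => f (s.toList.get i)) = s.map f := by
  have h : Finset.univ.val.map s.toList.get = s := by
    rw [Fin.univ_val_map, List.ofFn_get, Multiset.coe_toList]
  conv_rhs => rw [← h, Multiset.map_map]
  rfl

theorem exists_equiv_comp_eq {ι κ α : Type*} [Finite ι] [Finite κ] {f : ι → α} {g : κ → α}
    (h : ∀ a, Nat.card {i // f i = a} = Nat.card {j // g j = a}) :
    ∃ σ : ι ≃ κ, ∀ i, g (σ i) = f i :=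
  ⟨Equiv.ofFiberEquiv fun a => (Finite.card_eq.1 (h a)).some, Equiv.ofFiberEquiv_map _⟩

theorem map_pred_map_succ {s : Multiset ℕ} (hs : ∀ a ∈ s, 1 < a) :
    (s.map (· - 1)).map (· + 1) = s := by
  rw [Multiset.map_map]
  conv_rhs => rw [← Multiset.map_id s]
  refine Multiset.map_congr rfl fun a ha => ?_
  have := hs a ha
  simp only [Function.comp_apply, id]
  omega

/-! ### Product models indexed by factorizations. -/

namespace MVAlg

open MVAlgebra

/-- The product of the Łukasiewicz chains whose cardinalities are the members of `s`. -/
noncomputable def model (s : Multiset ℕ) : MVAlg.{u} :=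
  ⟨∀ i : Fin s.toList.length, Luk.{u} (s.toList.get i - 1)⟩

theorem one_le_get_sub_one {s : Multiset ℕ} (hs : ∀ a ∈ s, 1 < a) (i : Fin s.toList.length) :
    1 ≤ s.toList.get i - 1 := by
  have := hs _ (Multiset.mem_toList.1 (List.get_mem s.toList i))
  omega

theorem card_model {s : Multiset ℕ} (hs : ∀ a ∈ s, 1 < a) :
    Nat.card (model.{u} s).carrier = s.prod := by
  change Nat.card (∀ i : Fin s.toList.length, Luk.{u} (s.toList.get i - 1)) = _
  rw [Nat.card_pi]
  simp only [Luk.card_eq]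
  rw [Finset.prod, univ_map_toList_get s (fun a => a - 1 + 1)]
  have h := map_pred_map_succ hs
  rw [Multiset.map_map] at h
  exact congrArg Multiset.prod h

theorem exists_iso_model (A : MVAlg.{u}) [Finite A.carrier] :
    ∃ s : Multiset ℕ, (∀ a ∈ s, 1 < a) ∧ Nonempty (Iso A.carrier (model.{u} s).carrier) := by
  obtain ⟨ι, _, m, hm, ⟨f⟩⟩ := exists_iso_pi_luk A.carrier
  refine ⟨Finset.univ.val.map fun i => m i + 1, fun a ha => ?_, ?_⟩
  · obtain ⟨i, -, rfl⟩ := Multiset.mem_map.1 ha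
    exact Nat.lt_succ_of_le (hm i)
  · generalize hs : (Finset.univ.val.map fun i => m i + 1) = s
    -- `toList` orders the factors arbitrarily; equal fibre sizes provide a matching with the
    -- original index set.
    obtain ⟨σ, hσ⟩ := exists_equiv_comp_eq (f := fun j => s.toList.get j - 1) (g := m) fun k => by
      rw [card_fiber_eq_count, card_fiber_eq_count, univ_map_toList_get s (· - 1), ← hs,
        Multiset.map_map]
      rfl
    obtain rfl : (fun i => s.toList.get (σ.symm i) - 1) = m := by
      funext i
      rw [← hσ, Equiv.apply_symm_apply]
    exact ⟨f.trans (Iso.piCongrLeft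
      (fun j : Fin s.toList.length => Luk.{u} (s.toList.get j - 1)) σ.symm).symm⟩

theorem eq_of_iso_model {s t : Multiset ℕ} (hs : ∀ a ∈ s, 1 < a) (ht : ∀ a ∈ t, 1 < a)
    (e : Iso (model.{u} s).carrier (model.{u} t).carrier) : s = t := by
  rw [← map_pred_map_succ hs, ← map_pred_map_succ ht]
  congr 1
  ext k
  have := card_fiber_eq_of_iso (one_le_get_sub_one hs) (one_le_get_sub_one ht) e k
  rwa [card_fiber_eq_count, card_fiber_eq_count, univ_map_toList_get s (· - 1),
    univ_map_toList_get t (· - 1)] at this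

theorem isProductOfChains_model {s : Multiset ℕ} (hs : ∀ a ∈ s, 1 < a)
    (hc : 2 ≤ Multiset.card s) : IsProductOfChains (model.{u} s).carrier :=
  ⟨s.toList.length, fun i => Luk.{u} (s.toList.get i - 1), inferInstance,
    by rwa [Multiset.length_toList],
    fun i => ⟨Luk.nontrivial (one_le_get_sub_one hs i), Luk.isMVChain⟩,
    ⟨(isoSetoid.refl (model.{u} s)).some⟩⟩

/-- With at most one coordinate, comparing in that coordinate suffices; the empty multiset gives the
one-element algebra. -/
theorem isMVChain_model {s : Multiset ℕ} (hc : Multiset.card s ≤ 1) :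
    IsMVChain (model.{u} s).carrier := by
  have hsub : Subsingleton (Fin s.toList.length) := by
    rw [Fin.subsingleton_iff_le_one, Multiset.length_toList]
    exact hc
  have hle : ∀ {x y : ∀ i : Fin s.toList.length, Luk.{u} (s.toList.get i - 1)}
      (i : Fin s.toList.length), le (x i) (y i) → le x y := by
    intro x y i h
    rw [pi_le_iff]
    intro j
    rwa [Subsingleton.elim j i]
  intro x y
  by_cases hi : Nonempty (Fin s.toList.length)
  · obtain ⟨i⟩ := hi
    exact (Luk.isMVChain (x i) (y i)).imp (hle i) (hle i)
  · rw [not_nonempty_iff] at hi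
    left
    exact pi_le_iff.2 fun i => hi.elim i

end MVAlg

namespace MVAlgebra

theorem IsProductOfChains.not_isMVChain {M : Type u} [MVAlgebra M] (h : IsProductOfChains M) :
    ¬ IsMVChain M := by
  obtain ⟨k, C, _, hk, hC, ⟨e⟩⟩ := h
  have := fun i => (hC i).1
  exact fun h => not_isMVChain_pi C (i := ⟨0, by omega⟩) (j := ⟨1, by omega⟩) (by simp)
    (e.isMVChain h)

theorem IsProductOfChains.of_iso {M N : Type u} [MVAlgebra M] [MVAlgebra N]
    (h : IsProductOfChains M) (e : Iso M N) : IsProductOfChains N := by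
  obtain ⟨k, C, _, hk, hC, ⟨f⟩⟩ := h
  exact ⟨k, C, inferInstance, hk, hC, ⟨e.symm.trans f⟩⟩

theorem isProductOfChains_iff_not_isMVChain {M : Type u} [MVAlgebra M] [Finite M] :
    IsProductOfChains M ↔ ¬ IsMVChain M := by
  refine ⟨fun h => h.not_isMVChain, fun h => ?_⟩
  have : Finite (MVAlg.mk M).carrier := ‹Finite M›
  obtain ⟨s, hs, ⟨e⟩⟩ := MVAlg.exists_iso_model ⟨M⟩
  refine (MVAlg.isProductOfChains_model hs ?_).of_iso e.symm
  by_contra hc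
  exact h (e.symm.isMVChain (MVAlg.isMVChain_model (by omega)))

end MVAlgebra

namespace MVAlg

open MVAlgebra

/-- Isomorphism classes of `n`-element MV-algebras correspond to the factorizations of `n`. -/
theorem encard_isoClasses {n : ℕ} (hn : n ≠ 0) {P : MVAlg.{u} → Prop}
    (hP : ∀ A B : MVAlg.{u}, Iso A.carrier B.carrier → P A → P B) :
    (isoClasses.{u} n P).encard =
      {s : Multiset ℕ | (∀ a ∈ s, 1 < a) ∧ s.prod = n ∧ P (model.{u} s)}.encard := by
  have himage : isoClasses.{u} n P = (fun s => Quotient.mk isoSetoid.{u} (model.{u} s)) ''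
      {s : Multiset ℕ | (∀ a ∈ s, 1 < a) ∧ s.prod = n ∧ P (model.{u} s)} := by
    ext c
    constructor
    · rintro ⟨A, hA, hPA, rfl⟩
      have : Finite A.carrier := Nat.finite_of_card_ne_zero (hA ▸ hn)
      obtain ⟨s, hs, ⟨e⟩⟩ := exists_iso_model A
      refine ⟨s, ⟨hs, ?_, hP _ _ e hPA⟩, Quotient.sound ⟨e.symm⟩⟩
      rw [← card_model.{u} hs, ← hA]
      exact Nat.card_congr e.symm.toEquiv
    · rintro ⟨s, ⟨hs, hprod, hPs⟩, rfl⟩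
      exact ⟨model s, (card_model hs).trans hprod, hPs, rfl⟩
  rw [himage, Set.InjOn.encard_image]
  intro s hs t ht h
  obtain ⟨e⟩ := Quotient.exact h
  exact eq_of_iso_model hs.1 ht.1 e

end MVAlg

/-! ### Counting factorizations. -/

theorem card_le_prod {s : Multiset ℕ} (hs : ∀ a ∈ s, 1 < a) : Multiset.card s ≤ s.prod := by
  have h := Multiset.pow_card_le_prod (s := s) (a := 2) fun a ha => hs a ha
  exact Nat.lt_two_pow_self.le.trans h

/-- Every factor divides n and there are at most n of them, so s lies below n copies of `range (n +
1)`. Finiteness is needed because `ncard` of an infinite set is 0. -/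
theorem finite_properDecompositions {n : ℕ} (hn : n ≠ 0) : (properDecompositions n).Finite := by
  refine (Multiset.finite_toSet (Multiset.powerset (n • Multiset.range (n + 1)))).subset ?_
  rintro s ⟨-, hs, rfl⟩
  rw [Set.mem_ofPred_eq, Multiset.mem_powerset, Multiset.le_iff_count]
  intro a
  by_cases ha : a ∈ s
  · have hmem : a ∈ Multiset.range (s.prod + 1) :=
      Multiset.mem_range.2 (Nat.lt_succ_of_le
        (Nat.le_of_dvd (Nat.pos_of_ne_zero hn) (Multiset.dvd_prod ha)))
    rw [Multiset.count_nsmul]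
    exact ((Multiset.count_le_card a s).trans (card_le_prod hs)).trans
      (Nat.le_mul_of_pos_right _ (Multiset.count_pos.2 hmem))
  · rw [Multiset.count_eq_zero_of_notMem ha]
    exact Nat.zero_le _

theorem eq_singleton_or_mem_properDecompositions {n : ℕ} (hn : 2 ≤ n) {s : Multiset ℕ}
    (hs : ∀ a ∈ s, 1 < a) (hprod : s.prod = n) : s = {n} ∨ s ∈ properDecompositions n := by
  rcases Nat.lt_or_ge (Multiset.card s) 2 with hc | hc
  · left
    have h0 : Multiset.card s ≠ 0 := by
      intro h0
      rw [Multiset.card_eq_zero.1 h0, Multiset.prod_zero] at hprod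
      omega
    obtain ⟨a, rfl⟩ := Multiset.card_eq_one.1 (show Multiset.card s = 1 by omega)
    rw [← hprod, Multiset.prod_singleton]
  · exact Or.inr ⟨hc, hs, hprod⟩

/-- For `n ≥ 2` there are exactly `π(n) + 1` isomorphism classes of `n`-element MV-algebras:
exactly one class of MV-chains, and exactly `π(n)` classes of products of at least two
non-trivial MV-chains, the latter being precisely the `n`-element MV-algebras that are not
chains. -/
theorem proposition5p0 (n : ℕ) (hn : 2 ≤ n) :
    (MVAlg.isoClasses.{u} n (fun _ => True)).encard = ((numDecompositions n + 1 : ℕ) : ℕ∞) ∧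
    (MVAlg.isoClasses.{u} n (fun A => MVAlgebra.IsMVChain A.carrier)).encard = 1 ∧
    (MVAlg.isoClasses.{u} n (fun A => MVAlgebra.IsProductOfChains A.carrier)).encard =
      (numDecompositions n : ℕ∞) ∧
    (∀ A : MVAlg.{u}, Nat.card A.carrier = n →
      (MVAlgebra.IsProductOfChains A.carrier ↔ ¬ MVAlgebra.IsMVChain A.carrier)) := by
  have hn0 : n ≠ 0 := by omega
  have hfin := finite_properDecompositions hn0
  have hsing : ∀ a ∈ ({n} : Multiset ℕ), 1 < a := fun a ha => by
    rw [Multiset.mem_singleton.1 ha]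
    omega
  have hchain : MVAlgebra.IsMVChain (MVAlg.model.{u} {n}).carrier :=
    MVAlg.isMVChain_model (by simp)
  have hnotMem : ({n} : Multiset ℕ) ∉ properDecompositions n := fun h => by
    simpa using h.1
  have hprod : ∀ {s}, s ∈ properDecompositions n →
      MVAlgebra.IsProductOfChains (MVAlg.model.{u} s).carrier := fun h =>
    MVAlg.isProductOfChains_model h.2.1 h.1
  refine ⟨?_, ?_, ?_, fun A hA => ?_⟩
  -- The summand 1 is the factorization `{n}`, the only one that π(n) leaves out.
  · rw [MVAlg.encard_isoClasses hn0 fun _ _ _ h => h, numDecompositions, Nat.cast_add,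
      hfin.cast_ncard_eq, Nat.cast_one, ← Set.encard_insert_of_notMem hnotMem]
    congr 1
    ext s
    constructor
    · rintro ⟨hs, hp, -⟩
      exact eq_singleton_or_mem_properDecompositions hn hs hp
    · rintro (rfl | h)
      · exact ⟨hsing, Multiset.prod_singleton n, trivial⟩
      · exact ⟨h.2.1, h.2.2, trivial⟩
  · rw [MVAlg.encard_isoClasses hn0 fun _ _ e h => e.isMVChain h,
      ← Set.encard_singleton ({n} : Multiset ℕ)]
    congr 1
    ext s
    constructor
    · rintro ⟨hs, hp, hc⟩
      exact (eq_singleton_or_mem_properDecompositions hn hs hp).resolve_right fun h =>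
        (hprod h).not_isMVChain hc
    · rintro rfl
      exact ⟨hsing, Multiset.prod_singleton n, hchain⟩
  · rw [MVAlg.encard_isoClasses hn0 fun _ _ e h => h.of_iso e, numDecompositions,
      hfin.cast_ncard_eq]
    congr 1
    ext s
    constructor
    · rintro ⟨hs, hp, hc⟩
      refine (eq_singleton_or_mem_properDecompositions hn hs hp).resolve_left ?_
      rintro rfl
      exact hc.not_isMVChain hchain
    · exact fun h => ⟨h.2.1, h.2.2, hprod h⟩
  · have : Finite A.carrier := Nat.finite_of_card_ne_zero (hA ▸ hn0)
    exact MVAlgebra.isProductOfChains_iff_not_isMVChain
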